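/- **Setting.** Let $X$ and $Y$ be finite-dimensional real normed spaces (with $X$ identified with $\mathbb R^N$ through a basis), let $F:X\to Y$ be linear, let $y\in\operatorname{Rg}(F)$, and let $Y$ be uniformly smooth, i.e. its modulus of smoothness $\rho(t)=\sup\{\tfrac12(\|u+tu'\|+\|u-tu'\|)-1:\|u\|=\|u'\|=1\}$ satisfies $\rho(t)/t\to0$ as $t\to0^+$. Let $\mathcal R=\Phi:X\to\mathbb R$ be a scalar-valued neural network of some depth $L\ge 1$, that is, $\Phi(x)=z^{L+1}\in\mathbb R$ where $z^1=x$ and, for $k=1,\dots,L$, $z^{k+1}=\sigma^k\big(b^k+A^{k,j_k}z^{j_k}+W^k\hat z^k\big)$, with $\hat z^k$ equal either to $z^k$ or to the concatenation $(z^{i_k},z^k)$; here $i_k,j_k\in\{1,\dots,k\}$, the $z^k$ are vectors of arbitrary finite dimensions, $b^k$ are vectors, $A^{k,j_k},W^k$ are matrices and $\sigma^k$ are arbitrary (possibly nonlinear) maps. Assume that $\mathcal R$ is continuous and uniformly convex: there is a nonnegative function $h$ on $[0,\infty)$, with $h(s)=0$ if and only if $s=0$, such that $\mathcal R(tx+(1-t)x')+t(1-t)h(\|x-x'\|_X)\le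 t\mathcal R(x)+(1-t)\mathcal R(x')$ for all $t\in[0,1]$ and $x,x'\in X$. Write $\partial\mathcal R(x')=\{\xi\in X^*:\mathcal R(x)-\mathcal R(x')-\langle\xi,x-x'\rangle\ge0\ \ \forall x\in X\}$ and $\mathcal B^{\mathcal R}_\xi(x,x')=\mathcal R(x)-\mathcal R(x')-\langle\xi,x-x'\rangle$. Fix $r\in(1,\infty)$, $\tau>1$, $x_0\in X$, $\xi_0\in\partial\mathcal R(x_0)$, and positive numbers $(\alpha_n)_{n\ge1}$ with $\sum_{n\ge1}\alpha_n^{-1}=\infty$ and $\alpha_n\le c\,\alpha_{n+1}$ for all $n\ge 1$ and a constant $c>0$. Let $J_r(u)=\{j\in Y^*:\|j\|=\|u\|^{r-1},\ \langle j,u\rangle=\|u\|^r\}$ be the duality map. For data $v\in Y$, the iNETT iteration started at $(x_0,\xi_0)$ is, for $n\ge1$, $$x_n\in\operatorname*{argmin}_{x\in X}\ \tfrac1r\|Fx-v\|_Y^r+\alpha_n\mathcal B^{\mathcal R}_{\xi_{n-1}}(x,x_{n-1}),\qquad \xi_n\in\xi_{n-1}-\tfrac1{\alpha_n}F^TJ_r(Fx_n-v).$$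 **Theorem.** 1. (Well-posedness.) For every $v\in Y$ there is exactly one pair of sequences $(x_n)_{n\ge0},(\xi_n)_{n\ge0}$ generated by the iteration. For it, $\xi_n\in\partial\mathcal R(x_n)$ for all $n\ge0$; in every step the minimizer $x_n$ is unique, and $J_r(Fx_n-v)$ consists of exactly one element, for all $n\ge 1$. For each fixed $n$, $x_n$ and $\xi_n$ depend continuously on the data $v$. 2. There is a unique $\mathcal B^{\mathcal R}_{\xi_0}$-minimizing solution $x^\dagger$, i.e. a unique $x^\dagger\in X$ with $Fx^\dagger=y$ and $\mathcal B^{\mathcal R}_{\xi_0}(x^\dagger,x_0)=\min\{\mathcal B^{\mathcal R}_{\xi_0}(x,x_0):x\in X,\ Fx=y\}$. 3. (Finite stopping.) For every $\delta>0$ and every $y^\delta\in Y$ with $\|y^\delta-y\|_Y\le\delta$, the iterates $(x_n^\delta,\xi_n^\delta)$ for the data $v=y^\delta$ reach $\|Fx_n^\delta-y^\delta\|_Y\le\tau\delta$ after finitely many steps; let $n_\delta\ge0$ be the first such index $n$ (discrepancy principle). 4. (Convergence.) For every family of data $(y^\delta)_{\delta>0}$ with $\|y^\delta-y\|_Y\le\delta$,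 as $\delta\to0^+$, $$x^\delta_{n_\delta}\to x^\dagger,\qquad \mathcal R(x^\delta_{n_\delta})\to\mathcal R(x^\dagger),\qquad \mathcal B^{\mathcal R}_{\xi^\delta_{n_\delta}}(x^\dagger,x^\delta_{n_\delta})\to0.$$ -/

import Mathlib

open Filter Topology

noncomputable section

namespace INETT

/-- The width of the vector `ẑᵏ` that enters a layer: the width of `zᵏ` if there is no
concatenation, and the sum of the widths of `zⁱ` and `zᵏ` for the concatenation `C(zⁱ, zᵏ)`. -/
def hatWidth (width : ℕ → ℕ) (k : ℕ) : Option (Fin (k + 1)) → ℕ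
  | none => width k
  | some i => width i + width k

/-- The vector `ẑᵏ`, computed from `z⁰, …, zᵏ`: either `zᵏ` or the concatenation `C(zⁱ, zᵏ)`. -/
def hatState (width : ℕ → ℕ) (k : ℕ) (z : (i : Fin (k + 1)) → Fin (width i) → ℝ) :
    (o : Option (Fin (k + 1))) → Fin (hatWidth width k o) → ℝ
  | none => z (Fin.last k)
  | some i => Fin.append (z i) (z (Fin.last k))

/-- A neural network with skip connections and concatenations. States and layers are numbered
from `0`: the input is `z⁰ = x`, and layer `k` (for `k < depth`) computes
`zᵏ⁺¹ = σᵏ (bᵏ + Aᵏ z^(jₖ) + Wᵏ ẑᵏ)`, where `ẑᵏ` is `zᵏ` or `C(z^(iₖ), zᵏ)` and `iₖ, jₖ ≤ k`.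
The output is `z^depth`. (Layers with index `≥ depth` are not used.) -/
structure NeuralNetwork where
  /-- the depth `L` -/
  depth : ℕ
  depth_pos : 0 < depth
  /-- `zᵏ` is a vector in `ℝ ^ (width k)` -/
  width : ℕ → ℕ
  /-- the operator `σᵏ` acts on `ℝ ^ (preWidth k)` -/
  preWidth : ℕ → ℕ
  /-- the possibly nonlinear operators `σᵏ` -/
  act : (k : ℕ) → (Fin (preWidth k) → ℝ) → (Fin (width (k + 1)) → ℝ)
  /-- `some i` if layer `k` uses the concatenation `C(zⁱ, zᵏ)`, and `none` if it uses `zᵏ` -/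
  concatIndex : (k : ℕ) → Option (Fin (k + 1))
  /-- the index `jₖ` of the state that is added to the bias -/
  skipIndex : (k : ℕ) → Fin (k + 1)
  /-- the bias terms `bᵏ` -/
  bias : (k : ℕ) → Fin (preWidth k) → ℝ
  /-- the matrices `A^(k, jₖ)` -/
  skipMatrix : (k : ℕ) → Matrix (Fin (preWidth k)) (Fin (width (skipIndex k))) ℝ
  /-- the matrices `Wᵏ` -/
  weight : (k : ℕ) → Matrix (Fin (preWidth k)) (Fin (hatWidth width k (concatIndex k))) ℝ

namespace NeuralNetwork

/-- Layer `k`: the state `zᵏ⁺¹` as a function of `z⁰, …, zᵏ`. -/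
def layer (Φ : NeuralNetwork) (k : ℕ) (z : (i : Fin (k + 1)) → Fin (Φ.width i) → ℝ) :
    Fin (Φ.width (k + 1)) → ℝ :=
  Φ.act k (Φ.bias k + (Φ.skipMatrix k).mulVec (z (Φ.skipIndex k)) +
    (Φ.weight k).mulVec (hatState Φ.width k z (Φ.concatIndex k)))

/-- The states `zᵏ` of the network on the input `x`. -/
def state (Φ : NeuralNetwork) (x : Fin (Φ.width 0) → ℝ) : (k : ℕ) → Fin (Φ.width k) → ℝ
  | 0 => x
  | k + 1 => Φ.layer k (fun i => state Φ x i)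
  decreasing_by exact i.isLt

/-- The map computed by the network. -/
def eval (Φ : NeuralNetwork) (x : Fin (Φ.width 0) → ℝ) : Fin (Φ.width Φ.depth) → ℝ :=
  Φ.state x Φ.depth

end NeuralNetwork

section Norms

variable (Y : Type*) [NormedAddCommGroup Y] [NormedSpace ℝ Y]

/-- The modulus of smoothness. The set is bounded above by `|τ|`. -/
def smoothnessModulus (τ : ℝ) : ℝ :=
  sSup {s : ℝ | ∃ y y' : Y, ‖y‖ = 1 ∧ ‖y'‖ = 1 ∧ s = (‖y + τ • y'‖ + ‖y - τ • y'‖) / 2 - 1}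

/-- Uniform smoothness: `ρ(τ) / τ → 0` as `τ → 0⁺`. -/
def IsUniformlySmooth : Prop :=
  Tendsto (fun τ : ℝ => smoothnessModulus Y τ / τ) (𝓝[>] 0) (𝓝 0)

variable {Y}

/-- The duality map `J_r`, as a set-valued map. -/
def dualityMap (r : ℝ) (u : Y) : Set (StrongDual ℝ Y) :=
  {j | ‖j‖ = ‖u‖ ^ (r - 1) ∧ j u = ‖u‖ ^ r}

end Norms

section Functional

variable {X : Type*} [NormedAddCommGroup X] [NormedSpace ℝ X]

/-- Uniform convexity of a finite real-valued functional on the whole space: there is a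
nonnegative `h` on `[0, ∞)` which vanishes exactly at `0` and for which
`R (t x + (1 - t) x') + t (1 - t) h ‖x - x'‖ ≤ t R x + (1 - t) R x'`. (As `R` has finite values,
`h` is finite at every distance that occurs, so `h` may be taken real-valued.) -/
def IsUniformlyConvex (R : X → ℝ) : Prop :=
  ∃ h : ℝ → ℝ, (∀ s, 0 ≤ s → 0 ≤ h s ∧ (h s = 0 ↔ s = 0)) ∧ UniformConvexOn Set.univ h R

/-- The set of subgradients of `R` at `x'`. -/
def subdifferential (R : X → ℝ) (x' : X) : Set (StrongDual ℝ X) :=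
  {ξ | ∀ x, 0 ≤ R x - R x' - ξ (x - x')}

/-- The Bregman distance from `x` to `x'` in the direction `ξ`. -/
def bregman (R : X → ℝ) (ξ : StrongDual ℝ X) (x x' : X) : ℝ :=
  R x - R x' - ξ (x - x')

variable {Y : Type*} [NormedAddCommGroup Y] [NormedSpace ℝ Y]

/-- `xd` solves `F x = y` and minimizes the Bregman distance to `x₀` in the direction `ξ₀` among
all solutions. -/
def IsBregmanMinimizingSolution (F : X →ₗ[ℝ] Y) (y : Y) (R : X → ℝ) (x₀ : X)
    (ξ₀ : StrongDual ℝ X) (xd : X) : Prop :=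
  F xd = y ∧ ∀ x, F x = y → bregman R ξ₀ xd x₀ ≤ bregman R ξ₀ x x₀

/-- The functional that is minimized in one step of the iteration, for the data `v`, the step
parameter `a` and the previous iterate `(x', ξ')`. -/
def objective (F : X →ₗ[ℝ] Y) (R : X → ℝ) (r : ℝ) (v : Y) (a : ℝ) (x' : X)
    (ξ' : StrongDual ℝ X) (x : X) : ℝ :=
  1 / r * ‖F x - v‖ ^ r + a * bregman R ξ' x x'

/-- `(x n)` and `(ξ n)` are produced by the iteration for the data `v`, started at `(x₀, ξ₀)`:
`x (n + 1)` is a minimizer of the step functional and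
`ξ (n + 1) = ξ n - (α (n + 1))⁻¹ Fᵀ j` with `j` in the duality map at `F (x (n + 1)) - v`. -/
def IsIteration (F : X →ₗ[ℝ] Y) (R : X → ℝ) (r : ℝ) (α : ℕ → ℝ) (x₀ : X)
    (ξ₀ : StrongDual ℝ X) (v : Y) (x : ℕ → X) (ξ : ℕ → StrongDual ℝ X) : Prop :=
  x 0 = x₀ ∧ ξ 0 = ξ₀ ∧ ∀ n : ℕ,
    (∀ z, objective F R r v (α (n + 1)) (x n) (ξ n) (x (n + 1)) ≤
      objective F R r v (α (n + 1)) (x n) (ξ n) z) ∧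
    ∃ j ∈ dualityMap r (F (x (n + 1)) - v),
      ∀ z, ξ (n + 1) z = ξ n z - (α (n + 1))⁻¹ * j (F z)

/-- The discrepancy principle stops the iterates `x` for the data `v` at step `n`: this is the
first step, possibly `0`, at which the residual is at most `τ δ`. -/
def StopsAt (F : X →ₗ[ℝ] Y) (v : Y) (τ δ : ℝ) (x : ℕ → X) (n : ℕ) : Prop :=
  ‖F (x n) - v‖ ≤ τ * δ ∧ ∀ m < n, τ * δ < ‖F (x m) - v‖

end Functional

end INETT

end

noncomputable section

namespace INETT

theorem tendsto_of_ultrafilter_limit_unique {ι Z : Type*} [TopologicalSpace Z] {l : Filter ι}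
    {f : ι → Z} {K : Set Z} {z : Z} (hK : IsCompact K) (hf : ∀ᶠ i in l, f i ∈ K)
    (h : ∀ (U : Ultrafilter ι) (w : Z), (U : Filter ι) ≤ l → Tendsto f U (𝓝 w) → w = z) :
    Tendsto f l (𝓝 z) := by
  refine hK.tendsto_nhds_of_unique_mapClusterPt hf fun w _ hw => ?_
  obtain ⟨U, hU, hUw⟩ := mapClusterPt_iff_ultrafilter.1 hw
  exact h U w hU hUw

theorem exists_tendsto_ultrafilter {ι Z : Type*} [TopologicalSpace Z] {U : Ultrafilter ι}
    {f : ι → Z} {K : Set Z} (hK : IsCompact K) (hf : ∀ᶠ i in (U : Filter ι), f i ∈ K) :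
    ∃ w, Tendsto f U (𝓝 w) := by
  obtain ⟨w, -, hw⟩ := hK.ultrafilter_le_nhds (U.map f) (le_principal_iff.2 hf)
  exact ⟨w, hw⟩

theorem tendsto_dual_apply {ι E : Type*} [NormedAddCommGroup E] [NormedSpace ℝ E] {l : Filter ι}
    {f : ι → StrongDual ℝ E} {u : ι → E} {f₀ : StrongDual ℝ E} {u₀ : E}
    (hf : Tendsto f l (𝓝 f₀)) (hu : Tendsto u l (𝓝 u₀)) :
    Tendsto (fun i => f i (u i)) l (𝓝 (f₀ u₀)) :=
  (isBoundedBilinearMap_apply.continuous.tendsto (f₀, u₀)).comp (hf.prodMk_nhds hu)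

section DualityMap

variable {Y : Type*} [NormedAddCommGroup Y] [NormedSpace ℝ Y] {r : ℝ}

theorem norm_rpow_eq_mul {Y : Type*} [NormedAddCommGroup Y] {r : ℝ} (hr : 1 < r) (u : Y) : ‖u‖ ^ r = ‖u‖ ^ (r - 1) * ‖u‖ := by
  rcases eq_or_ne ‖u‖ 0 with h | h
  · rw [h, mul_zero, Real.zero_rpow (by linarith)]
  · rw [Real.rpow_sub_one h, div_mul_cancel₀ _ h]

theorem dualityMap_nonempty (hr : 1 < r) (u : Y) : (dualityMap r u).Nonempty := by
  rcases eq_or_ne u 0 with rfl | hu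
  · refine ⟨0, ?_, ?_⟩
    · rw [norm_zero, norm_zero, Real.zero_rpow (by linarith)]
    · simp [Real.zero_rpow (by linarith : r ≠ 0)]
  · obtain ⟨g, hg, hgu⟩ := exists_dual_vector ℝ u (norm_ne_zero_iff.2 hu)
    have h0 : 0 ≤ ‖u‖ ^ (r - 1) := by positivity
    refine ⟨‖u‖ ^ (r - 1) • g, ?_, ?_⟩
    · rw [norm_smul, hg, mul_one, Real.norm_of_nonneg h0]
    · rw [smul_apply, hgu, smul_eq_mul, norm_rpow_eq_mul hr]
      rfl

theorem bddAbove_smoothnessModulus_set (t : ℝ) :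
    BddAbove {s : ℝ | ∃ y y' : Y, ‖y‖ = 1 ∧ ‖y'‖ = 1 ∧
      s = (‖y + t • y'‖ + ‖y - t • y'‖) / 2 - 1} := by
  refine ⟨|t|, ?_⟩
  rintro s ⟨y, y', hy, hy', rfl⟩
  have h1 := norm_add_le y (t • y')
  have h2 := norm_sub_le y (t • y')
  rw [norm_smul, hy, hy', Real.norm_eq_abs] at h1 h2
  linarith

theorem dualityMap_subsingleton (hY : IsUniformlySmooth Y) (hr : 1 < r) (u : Y) :
    (dualityMap r u).Subsingleton := by
  rcases eq_or_ne u 0 with rfl | hu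
  · have h0 : ∀ j ∈ dualityMap r (0 : Y), j = 0 := by
      rintro j ⟨hj, -⟩
      rwa [norm_zero, Real.zero_rpow (by linarith), norm_eq_zero] at hj
    intro j hj k hk
    rw [h0 j hj, h0 k hk]
  have hN : 0 < ‖u‖ := norm_pos_iff.2 hu
  set c := ‖u‖ ^ (r - 1) with hc
  have hcpos : 0 < c := Real.rpow_pos_of_pos hN _
  set u₀ : Y := ‖u‖⁻¹ • u with hu₀
  have hu₀n : ‖u₀‖ = 1 := by
    rw [hu₀, norm_smul, norm_inv, norm_norm, inv_mul_cancel₀ hN.ne']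
  have hval : ∀ j ∈ dualityMap r u, j u₀ = c := by
    rintro j ⟨-, hj⟩
    rw [hu₀, map_smul, hj, norm_rpow_eq_mul hr, smul_eq_mul, ← hc]
    field_simp
  have key : ∀ j ∈ dualityMap r u, ∀ k ∈ dualityMap r u, ∀ w : Y, ‖w‖ = 1 → j w ≤ k w := by
    intro j hj k hk w hw
    have h1 : ∀ t : ℝ, 0 < t → (j w - k w) / (2 * c) ≤ smoothnessModulus Y t / t := by
      intro t ht
      have h2 : (‖u₀ + t • w‖ + ‖u₀ - t • w‖) / 2 - 1 ≤ smoothnessModulus Y t :=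
        le_csSup (bddAbove_smoothnessModulus_set t) ⟨u₀, w, hu₀n, hw, rfl⟩
      have h3 : c + t * j w ≤ c * ‖u₀ + t • w‖ := by
        have := (le_abs_self _).trans (j.le_opNorm (u₀ + t • w))
        rwa [hj.1, ← hc, map_add, hval j hj, map_smul, smul_eq_mul] at this
      have h4 : c - t * k w ≤ c * ‖u₀ - t • w‖ := by
        have := (le_abs_self _).trans (k.le_opNorm (u₀ - t • w))
        rwa [hk.1, ← hc, map_sub, hval k hk, map_smul, smul_eq_mul] at this
      rw [div_le_div_iff₀ (by positivity) ht]
      have := mul_le_mul_of_nonneg_left h2 hcpos.le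
      linarith
    have h5 : (j w - k w) / (2 * c) ≤ 0 :=
      ge_of_tendsto hY (eventually_nhdsWithin_of_forall h1)
    have h6 := (div_le_iff₀ (by positivity : 0 < 2 * c)).1 h5
    linarith
  intro j hj k hk
  rw [← sub_eq_zero, ← norm_le_zero_iff]
  refine ContinuousLinearMap.opNorm_le_of_unit_norm le_rfl fun w hw => ?_
  rw [sub_apply, le_antisymm (key j hj k hk w hw) (key k hk j hj w hw),
    sub_self, norm_zero]

/-- The elements of the duality map are subgradients of `u ↦ ‖u‖ ^ r / r`. -/
theorem add_le_of_mem_dualityMap (hr : 1 < r) {u : Y} {j : StrongDual ℝ Y}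
    (hj : j ∈ dualityMap r u) (w : Y) :
    1 / r * ‖u‖ ^ r + j (w - u) ≤ 1 / r * ‖w‖ ^ r := by
  have hpq : r.HolderConjugate (Real.conjExponent r) := Real.HolderConjugate.conjExponent hr
  have h1 : j w ≤ ‖w‖ * ‖u‖ ^ (r - 1) := by
    have := (le_abs_self _).trans (j.le_opNorm w)
    rwa [hj.1, mul_comm] at this
  have h2 := Real.young_inequality_of_nonneg (norm_nonneg w)
    (by positivity : 0 ≤ ‖u‖ ^ (r - 1)) hpq
  rw [← Real.rpow_mul (norm_nonneg u), hpq.sub_one_mul_conj, div_eq_mul_inv,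
    div_eq_mul_inv (‖u‖ ^ r), ← hpq.one_sub_inv] at h2
  rw [map_sub, hj.2, one_div]
  nlinarith

theorem tendsto_of_mem_dualityMap [FiniteDimensional ℝ Y] (hY : IsUniformlySmooth Y) (hr : 1 < r)
    {ι : Type*} {l : Filter ι} {u : ι → Y} {j : ι → StrongDual ℝ Y} {u₀ : Y} {j₀ : StrongDual ℝ Y}
    (hu : Tendsto u l (𝓝 u₀)) (hj : ∀ᶠ i in l, j i ∈ dualityMap r (u i))
    (hj₀ : j₀ ∈ dualityMap r u₀) : Tendsto j l (𝓝 j₀) := by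
  have hproper : ProperSpace (StrongDual ℝ Y) := FiniteDimensional.proper ℝ _
  have hpow : ∀ s : ℝ, 0 < s → ∀ l' ≤ l,
      Tendsto (fun i => ‖u i‖ ^ s) l' (𝓝 (‖u₀‖ ^ s)) := fun s hs l' hl' =>
    (hu.mono_left hl').norm.rpow_const (Or.inr hs.le)
  refine tendsto_of_ultrafilter_limit_unique
    (isCompact_closedBall (0 : StrongDual ℝ Y) (‖u₀‖ ^ (r - 1) + 1)) ?_ ?_
  · filter_upwards [hj, (hpow (r - 1) (by linarith) l le_rfl).eventually_lt_const
      (lt_add_one _)] with i hi hi'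
    rw [mem_closedBall_zero_iff, hi.1]
    exact hi'.le
  · intro U k hU hk
    refine dualityMap_subsingleton hY hr u₀ ⟨?_, ?_⟩ hj₀
    · refine tendsto_nhds_unique hk.norm ((hpow (r - 1) (by linarith) U hU).congr' ?_)
      filter_upwards [hj.filter_mono hU] with i hi using hi.1.symm
    · refine tendsto_nhds_unique (tendsto_dual_apply hk (hu.mono_left hU))
        ((hpow r (by linarith) U hU).congr' ?_)
      filter_upwards [hj.filter_mono hU] with i hi using hi.2.symm

end DualityMap

section Bregman

variable {X : Type*} [NormedAddCommGroup X] [NormedSpace ℝ X] {R : X → ℝ}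

theorem IsUniformlyConvex.apply_add_smul_le (hR : IsUniformlyConvex R) {t : ℝ} (ht : 0 ≤ t)
    (ht' : t ≤ 1) (x z : X) : R (x + t • (z - x)) ≤ R x + t * (R z - R x) := by
  obtain ⟨h, hh, -, hR⟩ := hR
  have h1 := hR (Set.mem_univ x) (Set.mem_univ z) (sub_nonneg.2 ht') ht (sub_add_cancel 1 t)
  have h2 : (1 - t) • x + t • z = x + t • (z - x) := by module
  have h3 : 0 ≤ (1 - t) * t * h ‖x - z‖ :=
    mul_nonneg (mul_nonneg (sub_nonneg.2 ht') ht) (hh _ (norm_nonneg _)).1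
  rw [h2, smul_eq_mul, smul_eq_mul] at h1
  linarith

theorem IsUniformlyConvex.apply_midpoint_lt (hR : IsUniformlyConvex R) {x z : X} (hxz : x ≠ z) :
    R ((1 / 2 : ℝ) • x + (1 / 2 : ℝ) • z) < (R x + R z) / 2 := by
  obtain ⟨h, hh, -, hR⟩ := hR
  have h1 := hR (Set.mem_univ x) (Set.mem_univ z) (by norm_num : (0 : ℝ) ≤ 1 / 2)
    (by norm_num : (0 : ℝ) ≤ 1 / 2) (by norm_num)
  have h2 : 0 < h ‖x - z‖ := by
    refine lt_of_le_of_ne (hh _ (norm_nonneg _)).1 fun h0 => hxz ?_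
    exact sub_eq_zero.1 (norm_eq_zero.1 ((hh _ (norm_nonneg _)).2.1 h0.symm))
  rw [smul_eq_mul, smul_eq_mul] at h1
  linarith

theorem bregman_nonneg {x' : X} {ξ : StrongDual ℝ X} (hξ : ξ ∈ subdifferential R x') (x : X) :
    0 ≤ bregman R ξ x x' := hξ x

/-- The Bregman distance of a uniformly convex functional grows at least linearly, uniformly in
the base point and the subgradient. -/
theorem IsUniformlyConvex.exists_mul_le_bregman (hR : IsUniformlyConvex R) :
    ∃ κ : ℝ, 0 < κ ∧ ∀ (x x' : X), ∀ ξ ∈ subdifferential R x',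
      κ * (‖x - x'‖ - 1) ≤ bregman R ξ x x' := by
  have hR' := hR
  obtain ⟨h, hh, -, hRh⟩ := hR
  have hpos : 0 < h 1 :=
    lt_of_le_of_ne (hh 1 zero_le_one).1 fun h0 => one_ne_zero ((hh 1 zero_le_one).2.1 h0.symm)
  refine ⟨h 1 / 2, by positivity, fun x x' ξ hξ => ?_⟩
  have hB := bregman_nonneg hξ x
  rcases lt_or_ge ‖x - x'‖ 1 with hd | hd
  · nlinarith
  set d := ‖x - x'‖ with hd'
  have hd0 : 0 < d := by linarith
  set p := x' + d⁻¹ • (x - x') with hp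
  have hpx : ‖p - x'‖ = 1 := by
    rw [hp, add_sub_cancel_left, norm_smul, norm_inv, ← hd', Real.norm_of_nonneg hd0.le,
      inv_mul_cancel₀ hd0.ne']
  have h1 := hR'.apply_add_smul_le (inv_nonneg.2 hd0.le) (inv_le_one_of_one_le₀ hd) x' x
  have h2 := hRh (Set.mem_univ p) (Set.mem_univ x') (by norm_num : (0 : ℝ) ≤ 1 / 2)
    (by norm_num : (0 : ℝ) ≤ 1 / 2) (by norm_num)
  have h3 := hξ ((1 / 2 : ℝ) • p + (1 / 2 : ℝ) • x')
  have h4 : (1 / 2 : ℝ) • p + (1 / 2 : ℝ) • x' - x' = (1 / 2 * d⁻¹) • (x - x') := by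
    rw [hp]; module
  rw [← hp] at h1
  rw [h4, map_smul, smul_eq_mul] at h3
  rw [hpx, smul_eq_mul, smul_eq_mul] at h2
  have h5 : h 1 / 2 ≤ d⁻¹ * bregman R ξ x x' := by
    unfold bregman; linarith
  have h6 : h 1 / 2 * d ≤ bregman R ξ x x' := by
    rw [← div_eq_inv_mul] at h5
    exact (le_div_iff₀ hd0).1 h5
  linarith

theorem mem_subdifferential_of_tendsto (hRc : Continuous R) {ι : Type*} {l : Filter ι} [l.NeBot]
    {x : ι → X} {ξ : ι → StrongDual ℝ X} {x₀ : X} {ξ₀ : StrongDual ℝ X}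
    (hx : Tendsto x l (𝓝 x₀)) (hξ : Tendsto ξ l (𝓝 ξ₀))
    (h : ∀ᶠ i in l, ξ i ∈ subdifferential R (x i)) : ξ₀ ∈ subdifferential R x₀ := fun z =>
  ge_of_tendsto (((tendsto_const_nhds (x := R z)).sub ((hRc.tendsto _).comp hx)).sub
    (tendsto_dual_apply hξ (tendsto_const_nhds.sub hx))) (h.mono fun _ hi => hi z)

theorem exists_norm_le_of_mem_subdifferential [FiniteDimensional ℝ X] (hRc : Continuous R)
    (M : ℝ) : ∃ C : ℝ, ∀ (x : X), ‖x‖ ≤ M → ∀ ξ ∈ subdifferential R x, ‖ξ‖ ≤ C := by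
  have : ProperSpace X := FiniteDimensional.proper ℝ X
  obtain ⟨C, hC⟩ := (isCompact_closedBall (0 : X) (M + 1)).exists_bound_of_continuousOn
    hRc.continuousOn
  refine ⟨2 * |C|, fun x hx ξ hξ => ?_⟩
  have key : ∀ w : X, ‖w‖ = 1 → ξ w ≤ 2 * |C| := by
    intro w hw
    have h1 := hξ (x + w)
    have h2 := (le_abs_self _).trans ((hC (x + w) (mem_closedBall_zero_iff.2 (by
      linarith [norm_add_le x w]))).trans (le_abs_self C))
    have h3 := (neg_le_abs _).trans ((hC x (mem_closedBall_zero_iff.2 (by linarith))).trans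
      (le_abs_self C))
    rw [add_sub_cancel_left] at h1
    linarith
  refine ContinuousLinearMap.opNorm_le_of_unit_norm (by positivity) fun w hw => ?_
  rw [Real.norm_eq_abs, abs_le]
  have := key (-w) (by rwa [norm_neg])
  rw [map_neg] at this
  exact ⟨by linarith, key w hw⟩

/-- A continuous function that dominates a multiple of a Bregman distance has minimizers. -/
theorem exists_minimizer_of_bregman_le [FiniteDimensional ℝ X] (hR : IsUniformlyConvex R)
    {x' : X} {ξ' : StrongDual ℝ X} (hξ : ξ' ∈ subdifferential R x') {a : ℝ} (ha : 0 < a)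
    {g : X → ℝ} (hg : Continuous g) (hga : ∀ x, a * bregman R ξ' x x' ≤ g x) {S : Set X}
    (hS : IsClosed S) (hne : S.Nonempty) : ∃ z ∈ S, ∀ w ∈ S, g z ≤ g w := by
  have : ProperSpace X := FiniteDimensional.proper ℝ X
  obtain ⟨κ, hκ, hB⟩ := hR.exists_mul_le_bregman
  obtain ⟨s, hs⟩ := hne
  refine hg.continuousOn.exists_isMinOn' hS hs (Eventually.filter_mono inf_le_left ?_)
  have h1 : Tendsto (fun x : X => a * (κ * (‖x‖ - ‖x'‖ - 1))) (cocompact X) atTop := by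
    refine Tendsto.const_mul_atTop ha (Tendsto.const_mul_atTop hκ ?_)
    simp_rw [sub_eq_add_neg]
    exact tendsto_atTop_add_const_right _ _ (tendsto_atTop_add_const_right _ _
      tendsto_norm_cocompact_atTop)
  filter_upwards [h1.eventually_ge_atTop (g s)] with x hx
  refine hx.trans (le_trans (mul_le_mul_of_nonneg_left ?_ ha.le) (hga x))
  refine le_trans (mul_le_mul_of_nonneg_left ?_ hκ.le) (hB x x' ξ' hξ)
  linarith [norm_sub_norm_le x x']

theorem existsUnique_isBregmanMinimizingSolution {Y : Type*} [NormedAddCommGroup Y]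
    [NormedSpace ℝ Y] [FiniteDimensional ℝ X] (F : X →ₗ[ℝ] Y) {y : Y}
    (hy : y ∈ LinearMap.range F) (hRc : Continuous R) (hR : IsUniformlyConvex R)
    {x₀ : X} {ξ₀ : StrongDual ℝ X} (hξ₀ : ξ₀ ∈ subdifferential R x₀) :
    ∃! xd : X, IsBregmanMinimizingSolution F y R x₀ ξ₀ xd := by
  have hFc : Continuous F := F.continuous_of_finiteDimensional
  have hBc : Continuous fun x => bregman R ξ₀ x x₀ := by unfold bregman; fun_prop
  obtain ⟨z, hz, hzmin⟩ := exists_minimizer_of_bregman_le hR hξ₀ one_pos hBc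
    (fun x => (one_mul _).le) (isClosed_singleton.preimage hFc : IsClosed (F ⁻¹' {y})) hy
  refine ⟨z, ⟨hz, hzmin⟩, fun w hw => ?_⟩
  by_contra hne
  have h1 := hR.apply_midpoint_lt hne
  have hz' : F z = y := hz
  have h2 := hzmin ((1 / 2 : ℝ) • w + (1 / 2 : ℝ) • z) (by
    rw [Set.mem_preimage, map_add, map_smul, map_smul, hw.1, hz', Set.mem_singleton_iff]
    module)
  have h3 := hw.2 z hz
  have h4 : ξ₀ ((1 / 2 : ℝ) • w + (1 / 2 : ℝ) • z - x₀) =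
      1 / 2 * ξ₀ (w - x₀) + 1 / 2 * ξ₀ (z - x₀) := by
    rw [← smul_eq_mul, ← smul_eq_mul, ← map_smul, ← map_smul, ← map_add]
    congr 1; module
  unfold bregman at h2 h3
  rw [h4] at h2
  linarith

end Bregman

section Step

variable {X Y : Type*} [NormedAddCommGroup X] [NormedSpace ℝ X]
  [NormedAddCommGroup Y] [NormedSpace ℝ Y] {F : X →ₗ[ℝ] Y} {R : X → ℝ} {r : ℝ}

theorem tendsto_objective [FiniteDimensional ℝ X] (hRc : Continuous R) (hr : 1 < r) {a : ℝ} {ι : Type*} {l : Filter ι}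
    {v : ι → Y} {x' z : ι → X} {ξ' : ι → StrongDual ℝ X} {v₀ : Y} {x₀' z₀ : X}
    {ξ₀' : StrongDual ℝ X} (hv : Tendsto v l (𝓝 v₀)) (hx : Tendsto x' l (𝓝 x₀'))
    (hξ : Tendsto ξ' l (𝓝 ξ₀')) (hz : Tendsto z l (𝓝 z₀)) :
    Tendsto (fun i => objective F R r (v i) a (x' i) (ξ' i) (z i)) l
      (𝓝 (objective F R r v₀ a x₀' ξ₀' z₀)) := by
  have hFc : Continuous F := F.continuous_of_finiteDimensional
  refine (((((hFc.tendsto z₀).comp hz).sub hv).norm.rpow_const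
    (Or.inr (by linarith))).const_mul _).add (Tendsto.const_mul _ ?_)
  exact ((((hRc.tendsto z₀).comp hz).sub ((hRc.tendsto x₀').comp hx))).sub
    (tendsto_dual_apply hξ (hz.sub hx))

theorem bregman_le_objective (hr : 1 < r) (v : Y) (a : ℝ) (x' : X) (ξ' : StrongDual ℝ X) (x : X) :
    a * bregman R ξ' x x' ≤ objective F R r v a x' ξ' x :=
  le_add_of_nonneg_left (mul_nonneg (by positivity) (by positivity))

theorem exists_minimizer_objective [FiniteDimensional ℝ X] (hRc : Continuous R)
    (hR : IsUniformlyConvex R) (hr : 1 < r) (v : Y) {a : ℝ} (ha : 0 < a) {x' : X} {ξ' : StrongDual ℝ X}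
    (hξ : ξ' ∈ subdifferential R x') :
    ∃ z, ∀ w, objective F R r v a x' ξ' z ≤ objective F R r v a x' ξ' w := by
  obtain ⟨z, -, hz⟩ := exists_minimizer_of_bregman_le hR hξ ha
    (g := objective F R r v a x' ξ')
    (continuous_iff_continuousAt.2 fun z => tendsto_objective hRc hr tendsto_const_nhds
      tendsto_const_nhds tendsto_const_nhds tendsto_id)
    (fun x => bregman_le_objective hr v a x' ξ' x) isClosed_univ Set.univ_nonempty
  exact ⟨z, fun w => hz w (Set.mem_univ w)⟩

theorem minimizer_objective_unique (hR : IsUniformlyConvex R) (hr : 1 < r)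
    {v : Y} {a : ℝ} (ha : 0 < a) {x' : X} {ξ' : StrongDual ℝ X} {z z' : X}
    (hz : ∀ w, objective F R r v a x' ξ' z ≤ objective F R r v a x' ξ' w)
    (hz' : ∀ w, objective F R r v a x' ξ' z' ≤ objective F R r v a x' ξ' w) : z = z' := by
  by_contra hne
  have h1 := hR.apply_midpoint_lt hne
  set m := (1 / 2 : ℝ) • z + (1 / 2 : ℝ) • z' with hm
  obtain ⟨j, hj⟩ := dualityMap_nonempty hr (F m - v)
  have h2 := add_le_of_mem_dualityMap hr hj (F z - v)
  have h3 := add_le_of_mem_dualityMap hr hj (F z' - v)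
  have h4 : j (F z - v - (F m - v)) = - j (F z' - v - (F m - v)) := by
    rw [← map_neg, hm, map_add, map_smul, map_smul]
    congr 1; module
  have h5 : ξ' (m - x') = 1 / 2 * ξ' (z - x') + 1 / 2 * ξ' (z' - x') := by
    rw [← smul_eq_mul, ← smul_eq_mul, ← map_smul, ← map_smul, ← map_add, hm]
    congr 1; module
  have h6 := hz m
  have h7 := hz' m
  unfold objective bregman at h6 h7
  rw [h5] at h6 h7
  have h8 := mul_lt_mul_of_pos_left h1 ha
  linarith

/-- First-order optimality of a minimizer: the updated dual variable is a subgradient. -/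
theorem mem_subdifferential_of_minimizer [FiniteDimensional ℝ Y] (hY : IsUniformlySmooth Y)
    (hR : IsUniformlyConvex R) (hr : 1 < r) {v : Y} {a : ℝ} (ha : 0 < a) {x' z : X}
    {ξ' ξ'' : StrongDual ℝ X}
    (hz : ∀ w, objective F R r v a x' ξ' z ≤ objective F R r v a x' ξ' w)
    {j : StrongDual ℝ Y} (hj : j ∈ dualityMap r (F z - v))
    (hξ : ∀ w, ξ'' w = ξ' w - a⁻¹ * j (F w)) : ξ'' ∈ subdifferential R z := by
  intro w
  choose J hJ using fun u : Y => dualityMap_nonempty hr u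
  set u := F z - v
  set d := F (w - z) with hd
  have h1 : ∀ t ∈ Set.Ioc (0 : ℝ) 1,
      0 ≤ J (u + t • d) d + a * (R w - R z - ξ' (w - z)) := by
    rintro t ⟨ht, ht'⟩
    have h2 := hz (z + t • (w - z))
    have h3 := hR.apply_add_smul_le ht.le ht' z w
    have h4 := add_le_of_mem_dualityMap hr (hJ (u + t • d)) u
    have h5 : F (z + t • (w - z)) - v = u + t • d := by
      rw [map_add, map_smul, ← hd]; simp only [u]; abel
    have h6 : ξ' (z + t • (w - z) - x') = ξ' (z - x') + t * ξ' (w - z) := by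
      rw [← smul_eq_mul, ← map_smul, ← map_add]
      congr 1; abel
    rw [sub_add_cancel_left, map_neg, map_smul, smul_eq_mul] at h4
    unfold objective bregman at h2
    rw [h5, h6] at h2
    have h7 := mul_le_mul_of_nonneg_left h3 ha.le
    refine nonneg_of_mul_nonneg_right (a := t) ?_ ht
    change 1 / r * ‖u‖ ^ r + _ ≤ _ at h2
    linarith
  have h8 : Tendsto (fun t : ℝ => J (u + t • d)) (𝓝[>] 0) (𝓝 j) := by
    refine tendsto_of_mem_dualityMap hY hr (u := fun t : ℝ => u + t • d) ?_
      (Eventually.of_forall fun t => hJ _) hj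
    have : Continuous fun t : ℝ => u + t • d := by fun_prop
    simpa using (this.tendsto 0).mono_left nhdsWithin_le_nhds
  have h9 : 0 ≤ j d + a * (R w - R z - ξ' (w - z)) := by
    refine ge_of_tendsto ((tendsto_dual_apply h8 tendsto_const_nhds).add_const _) ?_
    filter_upwards [Ioc_mem_nhdsGT (zero_lt_one' ℝ)] with t ht using h1 t ht
  rw [hξ]
  have h10 := mul_nonneg (inv_nonneg.2 ha.le) h9
  rw [mul_add, inv_mul_cancel_left₀ ha.ne'] at h10
  linarith

theorem tendsto_minimizer [FiniteDimensional ℝ X] (hRc : Continuous R)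
    (hR : IsUniformlyConvex R) (hr : 1 < r) {a : ℝ} (ha : 0 < a) {ι : Type*} {l : Filter ι}
    {v : ι → Y} {x' z : ι → X} {ξ' : ι → StrongDual ℝ X} {v₀ : Y} {x₀' z₀ : X}
    {ξ₀' : StrongDual ℝ X} (hv : Tendsto v l (𝓝 v₀)) (hx : Tendsto x' l (𝓝 x₀'))
    (hξ : Tendsto ξ' l (𝓝 ξ₀')) (hsub : ∀ i, ξ' i ∈ subdifferential R (x' i))
    (hz : ∀ i w, objective F R r (v i) a (x' i) (ξ' i) (z i) ≤
      objective F R r (v i) a (x' i) (ξ' i) w)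
    (hz₀ : ∀ w, objective F R r v₀ a x₀' ξ₀' z₀ ≤ objective F R r v₀ a x₀' ξ₀' w) :
    Tendsto z l (𝓝 z₀) := by
  have : ProperSpace X := FiniteDimensional.proper ℝ X
  obtain ⟨κ, hκ, hB⟩ := hR.exists_mul_le_bregman
  set M := objective F R r v₀ a x₀' ξ₀' x₀' + 1 with hM
  refine tendsto_of_ultrafilter_limit_unique
    (isCompact_closedBall (0 : X) (‖x₀'‖ + 1 + (M / (a * κ) + 1))) ?_ ?_
  · filter_upwards [(tendsto_objective (F := F) hRc hr (a := a) hv hx hξ hx).eventually_lt_const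
      (lt_add_one _), hx.norm.eventually_lt_const (lt_add_one _)] with i hi hi'
    have h1 := (bregman_le_objective hr (v i) a (x' i) (ξ' i) (z i)).trans
      ((hz i (x' i)).trans hi.le)
    have h2 := mul_le_mul_of_nonneg_left (hB (z i) (x' i) (ξ' i) (hsub i)) ha.le
    have h3 : ‖z i - x' i‖ - 1 ≤ M / (a * κ) := by
      rw [le_div_iff₀ (by positivity)]; linarith
    rw [mem_closedBall_zero_iff]
    linarith [norm_sub_norm_le (z i) (x' i)]
  · intro U w hU hw
    refine minimizer_objective_unique hR hr ha (fun s => ?_) hz₀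
    exact le_of_tendsto_of_tendsto
      (tendsto_objective hRc hr (hv.mono_left hU) (hx.mono_left hU) (hξ.mono_left hU) hw)
      (tendsto_objective hRc hr (hv.mono_left hU) (hx.mono_left hU) (hξ.mono_left hU)
        tendsto_const_nhds) (Eventually.of_forall fun i => hz i s)

theorem bregman_step_le (hr : 1 < r) {v y : Y} {a δ : ℝ} (ha : 0 < a) {x' z s : X}
    {ξ' ξ'' : StrongDual ℝ X} (hξ' : ξ' ∈ subdifferential R x') {j : StrongDual ℝ Y}
    (hj : j ∈ dualityMap r (F z - v)) (hξ : ∀ w, ξ'' w = ξ' w - a⁻¹ * j (F w))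
    (hs : F s = y) (hvy : ‖v - y‖ ≤ δ) :
    bregman R ξ'' s z ≤
      bregman R ξ' s x' - a⁻¹ * (‖F z - v‖ ^ (r - 1) * (‖F z - v‖ - δ)) := by
  have h1 : j (F (s - z)) ≤ ‖F z - v‖ ^ (r - 1) * (δ - ‖F z - v‖) := by
    have h2 : F (s - z) = -(v - y) - (F z - v) := by rw [map_sub, hs]; abel
    have h3 : j (-(v - y)) ≤ ‖F z - v‖ ^ (r - 1) * δ := by
      refine ((le_abs_self _).trans (j.le_opNorm _)).trans ?_
      rw [hj.1, norm_neg]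
      gcongr
    rw [h2, map_sub, hj.2, norm_rpow_eq_mul hr]
    linarith
  have h4 := mul_le_mul_of_nonneg_left h1 (inv_nonneg.2 ha.le)
  have h5 := hξ' z
  have h6 : ξ' (s - z) = ξ' (s - x') - ξ' (z - x') := by
    rw [← map_sub]; congr 1; abel
  unfold bregman
  rw [hξ]
  linarith

theorem IsIteration.apply_eq_of_apply_eq_zero {α : ℕ → ℝ} {x₀ : X} {ξ₀ : StrongDual ℝ X} {v : Y}
    {x : ℕ → X} {ξ : ℕ → StrongDual ℝ X}
    (h : IsIteration F R r α x₀ ξ₀ v x ξ) {z : X} (hz : F z = 0) (n : ℕ) : ξ n z = ξ₀ z := by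
  induction n with
  | zero => rw [h.2.1]
  | succ n ih =>
    obtain ⟨-, j, -, hξ⟩ := h.2.2 n
    rw [hξ, hz, map_zero, mul_zero, sub_zero, ih]

end Step

section Iteration

variable {X Y : Type*} [NormedAddCommGroup X] [NormedSpace ℝ X]
  [NormedAddCommGroup Y] [NormedSpace ℝ Y] [FiniteDimensional ℝ Y] {F : X →ₗ[ℝ] Y} {R : X → ℝ}
  {r : ℝ} {α : ℕ → ℝ} {x₀ : X} {ξ₀ : StrongDual ℝ X}

theorem IsIteration.mem_subdifferential (hY : IsUniformlySmooth Y) (hR : IsUniformlyConvex R)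
    (hr : 1 < r) (hα : ∀ n, 1 ≤ n → 0 < α n) (hξ₀ : ξ₀ ∈ subdifferential R x₀) {v : Y}
    {x : ℕ → X} {ξ : ℕ → StrongDual ℝ X} (h : IsIteration F R r α x₀ ξ₀ v x ξ) (n : ℕ) :
    ξ n ∈ subdifferential R (x n) := by
  cases n with
  | zero => rwa [h.1, h.2.1]
  | succ n =>
    obtain ⟨hmin, j, hj, hξ⟩ := h.2.2 n
    exact mem_subdifferential_of_minimizer hY hR hr (hα _ n.succ_pos) hmin hj hξ

theorem existsUnique_isIteration [FiniteDimensional ℝ X] (hY : IsUniformlySmooth Y)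
    (hRc : Continuous R) (hR : IsUniformlyConvex R) (hr : 1 < r) (hα : ∀ n, 1 ≤ n → 0 < α n)
    (hξ₀ : ξ₀ ∈ subdifferential R x₀) (v : Y) :
    ∃! p : (ℕ → X) × (ℕ → StrongDual ℝ X), IsIteration F R r α x₀ ξ₀ v p.1 p.2 := by
  have step : ∀ (n : ℕ) (p : {p : X × StrongDual ℝ X // p.2 ∈ subdifferential R p.1}),
      ∃ q : {p : X × StrongDual ℝ X // p.2 ∈ subdifferential R p.1},
        (∀ z, objective F R r v (α (n + 1)) p.1.1 p.1.2 q.1.1 ≤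
          objective F R r v (α (n + 1)) p.1.1 p.1.2 z) ∧
        ∃ j ∈ dualityMap r (F q.1.1 - v),
          ∀ z, q.1.2 z = p.1.2 z - (α (n + 1))⁻¹ * j (F z) := by
    rintro n ⟨⟨x', ξ'⟩, hξ'⟩
    have ha := hα (n + 1) n.succ_pos
    obtain ⟨z, hz⟩ := exists_minimizer_objective (F := F) hRc hR hr v ha hξ'
    obtain ⟨j, hj⟩ := dualityMap_nonempty hr (F z - v)
    have hξ : ∀ w, (ξ' - (α (n + 1))⁻¹ • j.comp (LinearMap.toContinuousLinearMap F)) w =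
        ξ' w - (α (n + 1))⁻¹ * j (F w) := fun w => rfl
    exact ⟨⟨(z, _), mem_subdifferential_of_minimizer hY hR hr ha hz hj hξ⟩, hz, j, hj, hξ⟩
  choose next hnext using step
  let s : ℕ → {p : X × StrongDual ℝ X // p.2 ∈ subdifferential R p.1} :=
    fun n => Nat.rec ⟨(x₀, ξ₀), hξ₀⟩ next n
  have hs : IsIteration F R r α x₀ ξ₀ v (fun n => (s n).1.1) (fun n => (s n).1.2) :=
    ⟨rfl, rfl, fun n => hnext n (s n)⟩
  refine ⟨(_, _), hs, ?_⟩
  rintro ⟨x, ξ⟩ h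
  dsimp only at h
  have key : ∀ n, x n = (s n).1.1 ∧ ξ n = (s n).1.2 := by
    intro n
    induction n with
    | zero => exact ⟨h.1, h.2.1⟩
    | succ n ih =>
      obtain ⟨h1, j, hj, h2⟩ := h.2.2 n
      obtain ⟨h3, k, hk, h4⟩ := hs.2.2 n
      rw [ih.1, ih.2] at h1
      have hx := minimizer_objective_unique hR hr (hα (n + 1) n.succ_pos) h1 h3
      refine ⟨hx, ?_⟩
      rw [hx] at hj
      ext w
      rw [h2, dualityMap_subsingleton hY hr _ hj hk, ih.2]
      exact (h4 w).symm
  exact Prod.ext (funext fun n => (key n).1) (funext fun n => (key n).2)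

theorem continuous_iteration [FiniteDimensional ℝ X] (hY : IsUniformlySmooth Y)
    (hRc : Continuous R) (hR : IsUniformlyConvex R) (hr : 1 < r) (hα : ∀ n, 1 ≤ n → 0 < α n)
    (hξ₀ : ξ₀ ∈ subdifferential R x₀) {x : Y → ℕ → X} {ξ : Y → ℕ → StrongDual ℝ X}
    (h : ∀ v, IsIteration F R r α x₀ ξ₀ v (x v) (ξ v)) (n : ℕ) :
    Continuous (fun v => x v n) ∧ Continuous (fun v => ξ v n) := by
  induction n with
  | zero =>
    simp_rw [fun v => (h v).1, fun v => (h v).2.1]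
    exact ⟨continuous_const, continuous_const⟩
  | succ n ih =>
    have hx : Continuous fun v => x v (n + 1) := continuous_iff_continuousAt.2 fun v =>
      tendsto_minimizer hRc hR hr (hα (n + 1) n.succ_pos) tendsto_id (ih.1.tendsto v)
        (ih.2.tendsto v) (fun u => (h u).mem_subdifferential hY hR hr hα hξ₀ n)
        (fun u => ((h u).2.2 n).1) ((h v).2.2 n).1
    refine ⟨hx, ?_⟩
    have hFc : Continuous F := F.continuous_of_finiteDimensional
    choose j hj hξ using fun v => ((h v).2.2 n).2
    have hjc : Continuous j := continuous_iff_continuousAt.2 fun v =>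
      tendsto_of_mem_dualityMap hY hr (((hFc.comp hx).sub continuous_id).tendsto v)
        (Eventually.of_forall hj) (hj v)
    have heq : (fun v => ξ v (n + 1)) = fun v =>
        ξ v n - (α (n + 1))⁻¹ • (j v).comp (LinearMap.toContinuousLinearMap F) := by
      funext v
      ext w
      exact hξ v w
    rw [heq]
    have hcomp : Continuous fun v => (j v).comp (LinearMap.toContinuousLinearMap F) :=
      hjc.clm_comp continuous_const
    exact ih.2.sub (hcomp.const_smul (α (n + 1))⁻¹)

section Discrepancy

variable {v y : Y} {s : X} {δ τ c : ℝ} {x : ℕ → X} {ξ : ℕ → StrongDual ℝ X}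

theorem IsIteration.bregman_succ_le (hY : IsUniformlySmooth Y) (hR : IsUniformlyConvex R)
    (hr : 1 < r) (hα : ∀ n, 1 ≤ n → 0 < α n) (hξ₀ : ξ₀ ∈ subdifferential R x₀)
    (h : IsIteration F R r α x₀ ξ₀ v x ξ) (hs : F s = y) (hvy : ‖v - y‖ ≤ δ) (n : ℕ) :
    bregman R (ξ (n + 1)) s (x (n + 1)) ≤ bregman R (ξ n) s (x n) - (α (n + 1))⁻¹ *
      (‖F (x (n + 1)) - v‖ ^ (r - 1) * (‖F (x (n + 1)) - v‖ - δ)) := by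
  obtain ⟨-, j, hj, hξ⟩ := h.2.2 n
  exact bregman_step_le hr (hα _ n.succ_pos) (h.mem_subdifferential hY hR hr hα hξ₀ n) hj hξ hs hvy

theorem IsIteration.bregman_succ_le_of_lt (hY : IsUniformlySmooth Y) (hR : IsUniformlyConvex R)
    (hr : 1 < r) (hα : ∀ n, 1 ≤ n → 0 < α n) (hξ₀ : ξ₀ ∈ subdifferential R x₀)
    (h : IsIteration F R r α x₀ ξ₀ v x ξ) (hs : F s = y) (hδ : 0 < δ) (hvy : ‖v - y‖ ≤ δ)
    (hτ : 1 < τ) {n : ℕ} (hn : τ * δ < ‖F (x (n + 1)) - v‖) :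
    bregman R (ξ (n + 1)) s (x (n + 1)) ≤
      bregman R (ξ n) s (x n) - (α (n + 1))⁻¹ * ((τ - 1) * δ ^ r) := by
  refine (h.bregman_succ_le hY hR hr hα hξ₀ hs hvy n).trans (sub_le_sub_left ?_ _)
  refine mul_le_mul_of_nonneg_left ?_ (inv_nonneg.2 (hα _ n.succ_pos).le)
  have h1 : δ ^ r = δ ^ (r - 1) * δ := by
    rw [Real.rpow_sub_one hδ.ne', div_mul_cancel₀ _ hδ.ne']
  have h2 : δ ≤ ‖F (x (n + 1)) - v‖ := by nlinarith
  calc (τ - 1) * δ ^ r = δ ^ (r - 1) * (τ * δ - δ) := by rw [h1]; ring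
    _ ≤ _ := mul_le_mul (Real.rpow_le_rpow hδ.le h2 (by linarith)) (by linarith) (by nlinarith)
      (by positivity)

theorem IsIteration.bregman_le_sub_sum (hY : IsUniformlySmooth Y) (hR : IsUniformlyConvex R)
    (hr : 1 < r) (hα : ∀ n, 1 ≤ n → 0 < α n) (hξ₀ : ξ₀ ∈ subdifferential R x₀)
    (h : IsIteration F R r α x₀ ξ₀ v x ξ) (hs : F s = y) (hδ : 0 < δ) (hvy : ‖v - y‖ ≤ δ)
    (hτ : 1 < τ) (m : ℕ) (hm : ∀ n ≤ m, τ * δ < ‖F (x n) - v‖) :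
    bregman R (ξ m) s (x m) ≤
      bregman R ξ₀ s x₀ - (∑ n ∈ Finset.Icc 1 m, (α n)⁻¹) * ((τ - 1) * δ ^ r) := by
  induction m with
  | zero => rw [h.1, h.2.1]; simp
  | succ m ih =>
    have h1 := ih fun n hn => hm n (hn.trans m.le_succ)
    have h2 := h.bregman_succ_le_of_lt hY hR hr hα hξ₀ hs hδ hvy hτ (hm (m + 1) le_rfl)
    rw [Finset.sum_Icc_succ_top (by omega)]
    linarith

theorem IsIteration.exists_stopsAt (hY : IsUniformlySmooth Y) (hR : IsUniformlyConvex R)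
    (hr : 1 < r) (hα : ∀ n, 1 ≤ n → 0 < α n)
    (hαsum : Tendsto (fun m : ℕ => ∑ n ∈ Finset.Icc 1 m, (α n)⁻¹) atTop atTop)
    (hξ₀ : ξ₀ ∈ subdifferential R x₀) (h : IsIteration F R r α x₀ ξ₀ v x ξ)
    (hy : y ∈ LinearMap.range F) (hδ : 0 < δ) (hvy : ‖v - y‖ ≤ δ) (hτ : 1 < τ) :
    ∃ n, StopsAt F v τ δ x n := by
  classical
  obtain ⟨s, hs⟩ := hy
  have hex : ∃ n, ‖F (x n) - v‖ ≤ τ * δ := by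
    by_contra! hcon
    have hK : 0 < (τ - 1) * δ ^ r := mul_pos (by linarith) (by positivity)
    obtain ⟨m, hm⟩ := ((hαsum.atTop_mul_const hK).eventually_gt_atTop
      (bregman R ξ₀ s x₀)).exists
    have h1 := h.bregman_le_sub_sum hY hR hr hα hξ₀ hs hδ hvy hτ m fun n _ => hcon n
    have h2 := bregman_nonneg (h.mem_subdifferential hY hR hr hα hξ₀ m) s
    linarith
  exact ⟨Nat.find hex, Nat.find_spec hex, fun m hm => not_le.1 (Nat.find_min hex hm)⟩

theorem StopsAt.bregman_le (hY : IsUniformlySmooth Y) (hR : IsUniformlyConvex R)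
    (hr : 1 < r) (hα : ∀ n, 1 ≤ n → 0 < α n) (hc : 0 < c)
    (hαc : ∀ n, 1 ≤ n → α n ≤ c * α (n + 1))
    (hξ₀ : ξ₀ ∈ subdifferential R x₀) (h : IsIteration F R r α x₀ ξ₀ v x ξ)
    (hs : F s = y) (hδ : 0 < δ) (hδ' : δ ≤ 1) (hvy : ‖v - y‖ ≤ δ) (hτ : 1 < τ) {N : ℕ}
    (hN : StopsAt F v τ δ x N) :
    bregman R (ξ N) s (x N) ≤
      bregman R ξ₀ s x₀ + (α 1)⁻¹ + c * (bregman R ξ₀ s x₀ / (τ - 1)) := by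
  have hB₀ := bregman_nonneg hξ₀ s
  have hτ' : 0 < τ - 1 := by linarith
  have hα1 := inv_pos.2 (hα 1 le_rfl)
  have hq : 0 ≤ c * (bregman R ξ₀ s x₀ / (τ - 1)) := by positivity
  have hδr : 0 ≤ δ ^ r := by positivity
  have last : ∀ n, bregman R (ξ (n + 1)) s (x (n + 1)) ≤
      bregman R (ξ n) s (x n) + (α (n + 1))⁻¹ * δ ^ r := by
    intro n
    have h1 := h.bregman_succ_le hY hR hr hα hξ₀ hs hvy n
    set ρ := ‖F (x (n + 1)) - v‖ with hρ
    have hρ0 : 0 ≤ ρ := norm_nonneg _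
    have h2 : ρ ^ (r - 1) * (δ - ρ) ≤ δ ^ r := by
      rcases le_total ρ δ with hle | hle
      · have h3 : δ ^ r = δ ^ (r - 1) * δ := by
          rw [Real.rpow_sub_one hδ.ne', div_mul_cancel₀ _ hδ.ne']
        rw [h3]
        exact mul_le_mul (Real.rpow_le_rpow hρ0 hle (by linarith)) (by linarith)
          (by linarith) (by positivity)
      · exact (mul_nonpos_of_nonneg_of_nonpos (by positivity) (by linarith)).trans hδr
    have h4 := mul_le_mul_of_nonneg_left h2 (inv_nonneg.2 (hα (n + 1) n.succ_pos).le)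
    linarith
  rcases N with _ | _ | k
  · rw [h.1, h.2.1]; linarith
  · have h1 := last 0
    rw [h.1, h.2.1, zero_add] at h1
    have h2 := mul_le_mul_of_nonneg_left (Real.rpow_le_one hδ.le hδ' (by linarith : 0 ≤ r)) hα1.le
    rw [zero_add]
    linarith
  · have h1 := last (k + 1)
    have hsum := h.bregman_le_sub_sum hY hR hr hα hξ₀ hs hδ hvy hτ (k + 1)
      fun n hn => hN.2 n (by omega)
    have hpos := bregman_nonneg (h.mem_subdifferential hY hR hr hα hξ₀ (k + 1)) s
    have hak := hα (k + 1) k.succ_pos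
    have hak' := hα (k + 1 + 1) (k + 1).succ_pos
    have h2 : (α (k + 1))⁻¹ ≤ ∑ n ∈ Finset.Icc 1 (k + 1), (α n)⁻¹ :=
      Finset.single_le_sum (f := fun n => (α n)⁻¹)
        (fun i hi => inv_nonneg.2 (hα i (Finset.mem_Icc.1 hi).1).le)
        (Finset.mem_Icc.2 ⟨k.succ_pos, le_rfl⟩)
    have h3 := mul_le_mul_of_nonneg_right h2 (mul_nonneg hτ'.le hδr)
    have h4 : (α (k + 1))⁻¹ * δ ^ r ≤ bregman R ξ₀ s x₀ / (τ - 1) := by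
      rw [le_div_iff₀ hτ']; linarith
    have h5 : (α (k + 1 + 1))⁻¹ ≤ c * (α (k + 1))⁻¹ := by
      rw [← div_eq_mul_inv, inv_eq_one_div, div_le_div_iff₀ hak' hak, one_mul]
      exact hαc (k + 1) k.succ_pos
    have h6 := mul_le_mul_of_nonneg_right h5 hδr
    have h7 := mul_le_mul_of_nonneg_left h4 hc.le
    have h8 : 0 ≤ (α (k + 1))⁻¹ * ((τ - 1) * δ ^ r) := by positivity
    linarith

end Discrepancy

theorem tendsto_stopped_iterates [FiniteDimensional ℝ X] (hY : IsUniformlySmooth Y)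
    (hRc : Continuous R) (hR : IsUniformlyConvex R) (hr : 1 < r) {τ : ℝ} (hτ : 1 < τ)
    (hα : ∀ n, 1 ≤ n → 0 < α n) {c : ℝ} (hc : 0 < c) (hαc : ∀ n, 1 ≤ n → α n ≤ c * α (n + 1))
    (hξ₀ : ξ₀ ∈ subdifferential R x₀) {y : Y} {xd : X}
    (hxd : IsBregmanMinimizingSolution F y R x₀ ξ₀ xd) {yδ : ℝ → Y} {x : ℝ → ℕ → X}
    {ξ : ℝ → ℕ → StrongDual ℝ X} {N : ℝ → ℕ} (hyδ : ∀ δ, 0 < δ → ‖yδ δ - y‖ ≤ δ)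
    (h : ∀ δ, 0 < δ → IsIteration F R r α x₀ ξ₀ (yδ δ) (x δ) (ξ δ))
    (hN : ∀ δ, 0 < δ → StopsAt F (yδ δ) τ δ (x δ) (N δ)) :
    Tendsto (fun δ => x δ (N δ)) (𝓝[>] 0) (𝓝 xd) ∧
      Tendsto (fun δ => R (x δ (N δ))) (𝓝[>] 0) (𝓝 (R xd)) ∧
      Tendsto (fun δ => bregman R (ξ δ (N δ)) xd (x δ (N δ))) (𝓝[>] 0) (𝓝 0) := by
  have : ProperSpace X := FiniteDimensional.proper ℝ X
  have : ProperSpace (StrongDual ℝ X) := FiniteDimensional.proper ℝ _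
  have hFc : Continuous F := F.continuous_of_finiteDimensional
  have hpos : ∀ᶠ δ : ℝ in 𝓝[>] 0, 0 < δ := eventually_mem_nhdsWithin
  have hsub : ∀ δ, 0 < δ → ξ δ (N δ) ∈ subdifferential R (x δ (N δ)) := fun δ hδ =>
    (h δ hδ).mem_subdifferential hY hR hr hα hξ₀ _
  obtain ⟨κ, hκ, hB⟩ := hR.exists_mul_le_bregman
  obtain ⟨M, hM⟩ : ∃ M, ∀ᶠ δ : ℝ in 𝓝[>] 0, ‖x δ (N δ)‖ ≤ M := by
    refine ⟨‖xd‖ + ((bregman R ξ₀ xd x₀ + (α 1)⁻¹ +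
      c * (bregman R ξ₀ xd x₀ / (τ - 1))) / κ + 1), ?_⟩
    filter_upwards [Ioc_mem_nhdsGT (zero_lt_one' ℝ)] with δ hδ
    have h1 := (hN δ hδ.1).bregman_le hY hR hr hα hc hαc hξ₀ (h δ hδ.1) hxd.1 hδ.1 hδ.2
      (hyδ δ hδ.1) hτ
    have h2 := (hB xd _ _ (hsub δ hδ.1)).trans h1
    rw [mul_comm, ← le_div_iff₀ hκ] at h2
    have h3 := norm_sub_norm_le (x δ (N δ)) xd
    rw [norm_sub_rev] at h3
    linarith
  obtain ⟨C, hC⟩ := exists_norm_le_of_mem_subdifferential hRc M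
  have hξC : ∀ᶠ δ : ℝ in 𝓝[>] 0, ‖ξ δ (N δ)‖ ≤ C := by
    filter_upwards [hM, hpos] with δ h1 h2 using hC _ h1 _ (hsub δ h2)
  have hy : Tendsto yδ (𝓝[>] 0) (𝓝 y) := by
    rw [tendsto_iff_norm_sub_tendsto_zero]
    refine squeeze_zero' (Eventually.of_forall fun _ => norm_nonneg _) (hpos.mono hyδ) ?_
    exact tendsto_id.mono_left nhdsWithin_le_nhds
  have hxlim : Tendsto (fun δ => x δ (N δ)) (𝓝[>] 0) (𝓝 xd) := by
    refine tendsto_of_ultrafilter_limit_unique (isCompact_closedBall (0 : X) M)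
      (hM.mono fun δ hδ => mem_closedBall_zero_iff.2 hδ) fun U w hU hw => ?_
    obtain ⟨η, hη⟩ := exists_tendsto_ultrafilter (U := U)
      (isCompact_closedBall (0 : StrongDual ℝ X) C)
      ((hξC.filter_mono hU).mono fun δ hδ => mem_closedBall_zero_iff.2 hδ)
    have hηsub : η ∈ subdifferential R w :=
      mem_subdifferential_of_tendsto hRc hw hη ((hpos.filter_mono hU).mono hsub)
    have hηker : ∀ z, F z = 0 → η z = ξ₀ z := fun z hz =>
      tendsto_nhds_unique (tendsto_dual_apply hη tendsto_const_nhds)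
        (tendsto_const_nhds.congr' ((hpos.filter_mono hU).mono fun δ hδ =>
          ((h δ hδ).apply_eq_of_apply_eq_zero hz _).symm))
    have hFw : F w = y := by
      rw [← sub_eq_zero, ← norm_le_zero_iff]
      have h1 : Tendsto (fun δ : ℝ => τ * δ) U (𝓝 (τ * 0)) :=
        ((tendsto_id.mono_left nhdsWithin_le_nhds).mono_left hU).const_mul τ
      rw [mul_zero] at h1
      exact le_of_tendsto_of_tendsto
        ((((hFc.tendsto w).comp hw).sub (hy.mono_left hU)).norm) h1
        ((hpos.filter_mono hU).mono fun δ hδ => (hN δ hδ).1)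
    refine (existsUnique_isBregmanMinimizingSolution F ⟨xd, hxd.1⟩ hRc hR hξ₀).unique
      ⟨hFw, fun z hz => ?_⟩ hxd
    have h1 := hηsub z
    rw [hηker _ (by rw [map_sub, hz, hFw, sub_self])] at h1
    have h2 : ξ₀ (z - w) = ξ₀ (z - x₀) - ξ₀ (w - x₀) := by
      rw [← map_sub]; congr 1; abel
    unfold bregman
    linarith
  have hRlim := (hRc.tendsto xd).comp hxlim
  refine ⟨hxlim, hRlim, ?_⟩
  have h1 : Tendsto (fun δ => ξ δ (N δ) (xd - x δ (N δ))) (𝓝[>] 0) (𝓝 0) := by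
    have h2 : Tendsto (fun δ => C * ‖xd - x δ (N δ)‖) (𝓝[>] 0) (𝓝 0) := by
      simpa using ((tendsto_const_nhds (x := xd)).sub hxlim).norm.const_mul C
    refine squeeze_zero_norm' ?_ h2
    filter_upwards [hξC] with δ hδ
    exact ((ξ δ (N δ)).le_opNorm _).trans (mul_le_mul_of_nonneg_right hδ (norm_nonneg _))
  simpa [bregman] using ((tendsto_const_nhds (x := R xd)).sub hRlim).sub h1

end Iteration

end INETT

end

open INETT in
theorem mainTheorem5
    {X Y : Type*} [NormedAddCommGroup X] [NormedSpace ℝ X] [FiniteDimensional ℝ X]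
    [NormedAddCommGroup Y] [NormedSpace ℝ Y] [FiniteDimensional ℝ Y]
    (hY : INETT.IsUniformlySmooth Y)
    (F : X →ₗ[ℝ] Y) (y : Y) (hy : y ∈ LinearMap.range F)
    (Φ : INETT.NeuralNetwork) (hΦ : Φ.width Φ.depth = 1)
    (e : Module.Basis (Fin (Φ.width 0)) ℝ X)
    (R : X → ℝ) (hR : ∀ x, R x = Φ.eval (e.equivFun x) (Fin.cast hΦ.symm 0))
    (hRcont : Continuous R) (hRconv : INETT.IsUniformlyConvex R)
    (r : ℝ) (hr : 1 < r) (τ : ℝ) (hτ : 1 < τ)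
    (α : ℕ → ℝ) (hα : ∀ n, 1 ≤ n → 0 < α n)
    (hαsum : Tendsto (fun m : ℕ => ∑ n ∈ Finset.Icc 1 m, (α n)⁻¹) atTop atTop)
    (c : ℝ) (hc : 0 < c) (hαc : ∀ n, 1 ≤ n → α n ≤ c * α (n + 1))
    (x₀ : X) (ξ₀ : StrongDual ℝ X) (hξ₀ : ξ₀ ∈ INETT.subdifferential R x₀) :
    -- the method is well-posed, for arbitrary data `v`
    ((∀ v : Y, ∃! p : (ℕ → X) × (ℕ → StrongDual ℝ X),
        INETT.IsIteration F R r α x₀ ξ₀ v p.1 p.2) ∧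
      (∀ (v : Y) (x : ℕ → X) (ξ : ℕ → StrongDual ℝ X),
        INETT.IsIteration F R r α x₀ ξ₀ v x ξ →
          ∀ n : ℕ,
            ξ n ∈ INETT.subdifferential R (x n) ∧
            (∃! z : X, ∀ w : X, INETT.objective F R r v (α (n + 1)) (x n) (ξ n) z ≤
              INETT.objective F R r v (α (n + 1)) (x n) (ξ n) w) ∧
            (∃! j : StrongDual ℝ Y, j ∈ INETT.dualityMap r (F (x (n + 1)) - v))) ∧
      (∀ (x : Y → ℕ → X) (ξ : Y → ℕ → StrongDual ℝ X),
        (∀ v, INETT.IsIteration F R r α x₀ ξ₀ v (x v) (ξ v)) →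
          ∀ n : ℕ, Continuous (fun v => x v n) ∧ Continuous (fun v => ξ v n))) ∧
    -- there is a unique Bregman minimizing solution
    (∃! xd : X, INETT.IsBregmanMinimizingSolution F y R x₀ ξ₀ xd) ∧
    -- the discrepancy principle stops the iteration after finitely many steps
    (∀ (δ : ℝ) (v : Y) (x : ℕ → X) (ξ : ℕ → StrongDual ℝ X),
      0 < δ → ‖v - y‖ ≤ δ → INETT.IsIteration F R r α x₀ ξ₀ v x ξ →
        ∃ n, INETT.StopsAt F v τ δ x n) ∧
    -- convergence of the stopped iterates as `δ → 0`
    (∀ (xd : X), INETT.IsBregmanMinimizingSolution F y R x₀ ξ₀ xd →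
      ∀ (yδ : ℝ → Y) (x : ℝ → ℕ → X) (ξ : ℝ → ℕ → StrongDual ℝ X) (N : ℝ → ℕ),
        (∀ δ, 0 < δ → ‖yδ δ - y‖ ≤ δ) →
        (∀ δ, 0 < δ → INETT.IsIteration F R r α x₀ ξ₀ (yδ δ) (x δ) (ξ δ)) →
        (∀ δ, 0 < δ → INETT.StopsAt F (yδ δ) τ δ (x δ) (N δ)) →
          Tendsto (fun δ => x δ (N δ)) (𝓝[>] 0) (𝓝 xd) ∧
          Tendsto (fun δ => R (x δ (N δ))) (𝓝[>] 0) (𝓝 (R xd)) ∧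
          Tendsto (fun δ => INETT.bregman R (ξ δ (N δ)) xd (x δ (N δ))) (𝓝[>] 0) (𝓝 0)) := by
  refine ⟨⟨existsUnique_isIteration hY hRcont hRconv hr hα hξ₀, fun v x ξ h n => ?_,
    fun x ξ h n => continuous_iteration hY hRcont hRconv hr hα hξ₀ h n⟩,
    existsUnique_isBregmanMinimizingSolution F hy hRcont hRconv hξ₀,
    fun δ v x ξ hδ hv h => h.exists_stopsAt hY hRconv hr hα hαsum hξ₀ hy hδ hv hτ,
    fun xd hxd yδ x ξ N hyδ h hN =>
      tendsto_stopped_iterates hY hRcont hRconv hr hτ hα hc hαc hξ₀ hxd hyδ h hN⟩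
  have hsub := h.mem_subdifferential hY hRconv hr hα hξ₀ n
  have hmin := (h.2.2 n).1
  obtain ⟨j, hj⟩ := dualityMap_nonempty hr (F (x (n + 1)) - v)
  exact ⟨hsub, ⟨x (n + 1), hmin, fun z hz =>
    minimizer_objective_unique hRconv hr (hα (n + 1) n.succ_pos) hz hmin⟩,
    ⟨j, hj, fun k hk => dualityMap_subsingleton hY hr _ hk hj⟩⟩
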